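/- Let $(X,\mathcal A,\mu)$ be a $\sigma$-finite measure space with $\mu(X)=\infty$, let $T:X\to X$ be a conservative, ergodic, measure-preserving transformation, and let $Y\in\mathcal A$ with $0<\mu(Y)<\infty$. Write $\hat T u=\frac{d(\mu_u\circ T^{-1})}{d\mu}$, where $\mu_u(A)=\int_A u\,d\mu$, for the transfer operator on non-negative measurable functions $u$, and set $$Y_0=Y,\qquad Y_n=T^{-n}Y\setminus\bigcup_{k=0}^{n-1}T^{-k}Y\ (n\ge1),\qquad w_n^Y=\mu\Big(\bigcup_{k=0}^{n-1}T^{-k}Y\Big)\ (n\ge 0),$$ $$Q^Y(s)=\sum_{n\ge0}e^{-ns}\,(w_{n+1}^Y-w_n^Y)\ (s>0),\qquad S_n^Y(x)=\sum_{k=1}^n 1_Y(T^kx).$$ Assume that - $w_n^Y\sim n^{1-\alpha}\ell(n)$ as $n\to\infty$, for some $\alpha\in(0,1)$ and some positive, measurable function $\ell:(0,\infty)\to(0,\infty)$ slowly varying at $\infty$ (i.e. $\ell(\lambda t)/\ell(t)\to1$ as $t\to\infty$ for every $\lambda>0$); - the sequence $\Big\{\frac1{w_n^Y}\sum_{k=0}^{n-1}\hat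 T^k1_{Y_k}\Big\}_{n\ge1}$ is bounded in $L^\infty(\mu)$. For $t>0$ set $a(t)=\dfrac{t}{\Gamma(1+\alpha)\,Q^Y(1/t)}$. Then $$a(t)\sim\frac{t^\alpha}{\Gamma(1+\alpha)\Gamma(2-\alpha)\,\ell(t)}\qquad(t\to\infty),$$ and for every positive-valued sequence $\{\tilde c(n)\}_{n\ge0}$ with $\tilde c(n)\to0$ and $\tilde c(n)a(n)\to\infty$ as $n\to\infty$, $$\mu_{1_Y}\Big(\frac{S_n^Y}{a(n)}\le\tilde c(n)\Big)=\mu\Big(Y\cap\Big\{\frac{S_n^Y}{a(n)}\le\tilde c(n)\Big\}\Big)\sim\frac{\sin(\pi\alpha)}{\pi\alpha}\,\tilde c(n)\qquad(n\to\infty).$$ -/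

import Mathlib

open MeasureTheory Filter Topology Asymptotics Set
open scoped ENNReal NNReal

noncomputable section

namespace InfiniteErgodic

/-- A positive measurable function on `(0,∞)`, slowly varying at `∞`
(values outside `(0,∞)` are irrelevant). -/
structure IsSlowlyVarying (l : ℝ → ℝ) : Prop where
  pos : ∀ t : ℝ, 0 < t → 0 < l t
  measurable : Measurable fun t : Ioi (0 : ℝ) => l t
  tendsto : ∀ c : ℝ, 0 < c → Tendsto (fun t : ℝ => l (c * t) / l t) atTop (𝓝 1)

variable {X : Type*} [MeasurableSpace X]

/-- Conservative, ergodic, measure-preserving transformation (measure preservation is part of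
`Ergodic`). -/
structure IsCEMPT (T : X → X) (μ : Measure X) : Prop where
  conservative : Conservative T μ
  ergodic : Ergodic T μ

/-- The transfer operator on non-negative measurable functions:
`u ↦ d(μ_u ∘ T⁻¹)/dμ`, where `dμ_u = u dμ`. -/
def transfer (T : X → X) (μ : Measure X) (u : X → ℝ≥0∞) : X → ℝ≥0∞ :=
  ((μ.withDensity u).map T).rnDeriv μ

/-- `Y_n = T⁻ⁿ Y \ ⋃_{k<n} T⁻ᵏ Y`: the points which visit `Y` for the first time at time `n`
(so `Y_0 = Y`). -/
def firstVisit (T : X → X) (Y : Set X) (n : ℕ) : Set X :=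
  (T^[n] ⁻¹' Y) \ ⋃ k ∈ Finset.range n, T^[k] ⁻¹' Y

/-- The wandering rate `w_n^Y = μ(⋃_{k<n} T⁻ᵏ Y)`. -/
def wanderingRate (T : X → X) (μ : Measure X) (Y : Set X) (n : ℕ) : ℝ :=
  μ.real (⋃ k ∈ Finset.range n, T^[k] ⁻¹' Y)

/-- `Q^Y(s) = ∑_{n ≥ 0} e^{-ns} (w_{n+1}^Y - w_n^Y)`. -/
def wanderingLaplace (T : X → X) (μ : Measure X) (Y : Set X) (s : ℝ) : ℝ :=
  ∑' n : ℕ, Real.exp (-(n * s)) * (wanderingRate T μ Y (n + 1) - wanderingRate T μ Y n)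

/-- The normalised entrance sum `(1 / w_n^Y) ∑_{k<n} T̂ᵏ 1_{Y_k}`. -/
def entranceMean (T : X → X) (μ : Measure X) (Y : Set X) (n : ℕ) (x : X) : ℝ≥0∞ :=
  (∑ k ∈ Finset.range n, (transfer T μ)^[k] ((firstVisit T Y k).indicator 1) x) /
    ENNReal.ofReal (wanderingRate T μ Y n)

/-- The occupation time `S_n^A(x) = ∑_{k=1}^n 1_A(Tᵏ x)`. -/
def occupationTime (T : X → X) (A : Set X) (n : ℕ) (x : X) : ℝ :=
  ∑ k ∈ Finset.Icc 1 n, A.indicator (fun _ => (1 : ℝ)) (T^[k] x)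

/-- `a(t) = t / (Γ(1+α) Q^Y(1/t))`. -/
def normalizer (T : X → X) (μ : Measure X) (Y : Set X) (α t : ℝ) : ℝ :=
  t / (Real.Gamma (1 + α) * wanderingLaplace T μ Y t⁻¹)

end InfiniteErgodic

end

/-!
The proof counts visits to `Y` and needs no Laplace transform in time. Let `w n` be the wandering
rate, fix a threshold `m`, and let `p i` be the measure of the points of `Y` with fewer than `m`
returns to `Y` up to time `i` (`fewReturns`); it is antitone in `i`. If `R` is the number of visits
to `Y` before time `n`, then `min R m` counts those visits which are among the last `m`. As `T`
preserves `μ`, integration gives `∑_{i<n} p i = ∫ min R m ≤ m * w n` (`lintegral_min_visits`,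
`sum_measure_fewReturns_le`).

For the opposite bound, `min R m` can fall short of `m` on a point that visits `Y` before time `j`
only if fewer than `m` visits take place from its first visit up to time `n = j + i`
(`mul_measure_visited_le`). Distributing these points over the first visit times, the transfer
operator writes the measure of this set as an integral of `∑_{k<j} T̂ᵏ 1_{Y_k}`, which is bounded by
`C * w j`, over points of `Y` with few returns up to time `i`. Hence
`m * w j * (1 - C * p i) ≤ ∑_{k<j+i} p k`.

When `m = m_n` satisfies `m_n * w n / n → 0`, the upper bound and monotonicity show that `p i → 0`
for `i` of order `n`; with regular variation of `w`, the two bounds give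
`∑_{i<xn} p i ∼ x ^ (1 - α) * m_n * w n` for every `x > 0` (`SumBounds.tendsto_sum`). As `p` is
antitone, this may be differentiated: `p n ∼ (1 - α) * m_n * w n / n`
(`SumBounds.tendsto_density`). The event `S_n ≤ c n * a n` corresponds to `m_n = ⌊c n * a n⌋ + 1`,
which is asymptotic to `c n * a n`.

It remains to find the asymptotics of `a`. Abel summation gives
`Q (1 / t) = ∫ e^{-x} w (⌊x t⌋ + 1) dx`, and dominated convergence, with the domination coming from
subadditivity of `w`, yields `Q (1 / t) ∼ Γ (2 - α) * w ⌊t⌋` (`tendsto_wanderingLaplace_div`). The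
passage from integer to real arguments of the slowly varying function rests on the uniform
convergence theorem (`IsSlowlyVarying.tendsto_div_of_tendsto_div`). The constant
`(1 - α) / (Γ (1 + α) * Γ (2 - α))` is `sin (π α) / (π α)` by the reflection formula.
-/

namespace InfiniteErgodic

/-! ### Slowly varying functions and Laplace sums -/

/-- Pointwise convergence in `u` of `h (x + u) - h x` is automatically locally uniform when `h` is
measurable. On `[0, 2]` the differences converge in measure, along `x n` as well as along `y n`, so
some point is close in value to both `h (x n)` and `h (y n)`. -/
theorem tendsto_sub_of_translation_tendsto {h : ℝ → ℝ} (hm : Measurable h)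
    (hh : ∀ u : ℝ, Tendsto (fun x => h (x + u) - h x) atTop (𝓝 0)) {x y : ℕ → ℝ} {d : ℝ}
    (hx : Tendsto x atTop atTop) (hxy : Tendsto (fun n => y n - x n) atTop (𝓝 d)) :
    Tendsto (fun n => h (y n) - h (x n)) atTop (𝓝 0) := by
  have key : ∀ z : ℕ → ℝ, Tendsto z atTop atTop → ∀ ε : ℝ, 0 < ε → ∀ᶠ n in atTop,
      volume.restrict (Icc (0 : ℝ) 2) {v | ε ≤ |h (z n + v) - h (z n)|} < 1 / 4 := by
    intro z hz ε hε
    have hmeas : TendstoInMeasure (volume.restrict (Icc (0 : ℝ) 2))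
        (fun n v => h (z n + v) - h (z n)) atTop (fun _ => (0 : ℝ)) := by
      refine tendstoInMeasure_of_tendsto_ae (fun n => ?_) (ae_of_all _ fun v => (hh v).comp hz)
      exact ((hm.comp (measurable_const_add _)).sub_const _).aestronglyMeasurable
    have := (tendstoInMeasure_iff_norm.1 hmeas) ε hε
    simp only [sub_zero, Real.norm_eq_abs] at this
    exact this.eventually_lt_const (by simp)
  -- Replacing `x` by `x + d` reduces to the case `d = 0`.
  have hx' : Tendsto (fun n => x n + d) atTop atTop := tendsto_atTop_add_const_right _ _ hx
  have hy : Tendsto y atTop atTop := by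
    have := hx.atTop_add hxy
    simpa using this
  suffices H : Tendsto (fun n => h (y n) - h (x n + d)) atTop (𝓝 0) by
    have := H.add ((hh d).comp hx)
    simpa using this
  rw [Metric.tendsto_atTop']
  intro ε hε
  have hu : ∀ᶠ n in atTop, |y n - x n - d| < 1 / 2 := by
    have := hxy.sub_const d
    rw [sub_self] at this
    exact (this.abs.eventually_lt_const (by norm_num))
  obtain ⟨N, hN⟩ := eventually_atTop.1
    ((key _ hx' (ε / 2) (by positivity)).and ((key _ hy (ε / 2) (by positivity)).and hu))
  refine ⟨N, fun n hn => ?_⟩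
  obtain ⟨hV, hW, hu⟩ := hN n hn.le
  rw [abs_lt] at hu
  set u := y n - x n - d with hu_def
  set V := {v | ε / 2 ≤ |h (x n + d + v) - h (x n + d)|}
  set W := {v | ε / 2 ≤ |h (y n + v) - h (y n)|}
  have hVm : MeasurableSet V :=
    measurableSet_le measurable_const ((hm.comp (measurable_const_add _)).sub_const _).abs
  have hWm : MeasurableSet W :=
    measurableSet_le measurable_const ((hm.comp (measurable_const_add _)).sub_const _).abs
  -- The two exceptional sets, one of them shifted by `u`, cannot cover `[1/2, 3/2]`.
  have hex : ∃ v ∈ Icc (1 / 2 : ℝ) (3 / 2), v ∉ V ∧ v + -u ∉ W := by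
    by_contra! hcon
    have hsub : Icc (1 / 2 : ℝ) (3 / 2) ⊆
        (V ∩ Icc 0 2) ∪ (fun v => v + -u) ⁻¹' (W ∩ Icc 0 2) := by
      intro v hv
      by_cases hvV : v ∈ V
      · exact Or.inl ⟨hvV, by linarith [hv.1], by linarith [hv.2]⟩
      · exact Or.inr ⟨hcon v hv hvV, by linarith [hv.1], by linarith [hv.2]⟩
    have h1 := (measure_mono hsub).trans (measure_union_le (μ := volume) _ _)
    rw [measure_preimage_add_right, ← Measure.restrict_apply hVm, ← Measure.restrict_apply hWm,
      Real.volume_Icc] at h1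
    have h2 := h1.trans_lt (ENNReal.add_lt_add hV hW)
    rw [show (1 / 4 : ℝ≥0∞) = ENNReal.ofReal (1 / 4) by
        rw [ENNReal.ofReal_div_of_pos (by norm_num)]; simp,
      ← ENNReal.ofReal_add (by norm_num) (by norm_num), ENNReal.ofReal_lt_ofReal_iff'] at h2
    norm_num at h2
  obtain ⟨v, -, hvV, hvW⟩ := hex
  simp only [V, W, mem_ofPred_eq, not_le] at hvV hvW
  rw [show y n + (v + -u) = x n + d + v by rw [hu_def]; ring] at hvW
  rw [Real.dist_eq, sub_zero]
  rw [abs_lt] at hvV hvW ⊢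
  constructor <;> linarith [hvV.1, hvV.2, hvW.1, hvW.2]

/-- The uniform convergence theorem for slowly varying functions, which allows the values at
integers to be compared with those at real arguments. -/
theorem IsSlowlyVarying.tendsto_div_of_tendsto_div {l : ℝ → ℝ} (hl : IsSlowlyVarying l)
    {y : ℝ → ℝ} {c : ℝ} (hc : 0 < c) (hy : Tendsto (fun t => y t / t) atTop (𝓝 c)) :
    Tendsto (fun t => l (y t) / l t) atTop (𝓝 1) := by
  set h : ℝ → ℝ := fun x => Real.log (l (Real.exp x)) with hh_def
  have hm : Measurable h := by
    refine Real.measurable_log.comp (hl.measurable.comp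
      (f := fun x : ℝ => (⟨Real.exp x, Real.exp_pos x⟩ : Ioi (0 : ℝ))) ?_)
    exact Real.measurable_exp.subtype_mk
  have hpos : ∀ x, 0 < l (Real.exp x) := fun x => hl.pos _ (Real.exp_pos x)
  have hh : ∀ u : ℝ, Tendsto (fun x => h (x + u) - h x) atTop (𝓝 0) := by
    intro u
    have h1 := ((hl.tendsto (Real.exp u) (Real.exp_pos u)).comp Real.tendsto_exp_atTop).log
      one_ne_zero
    rw [Real.log_one] at h1
    refine h1.congr fun x => ?_
    simp only [Function.comp, hh_def]
    rw [Real.exp_add, mul_comm (Real.exp x), Real.log_div (hl.pos _ (by positivity)).ne'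
      (hpos x).ne']
  refine tendsto_of_seq_tendsto fun t ht => ?_
  have hty := hy.comp ht
  have hlog := hty.log hc.ne'
  have ht0 : ∀ᶠ n in atTop, 0 < t n := ht.eventually_gt_atTop 0
  have hy0 : ∀ᶠ n in atTop, 0 < y (t n) := by
    filter_upwards [ht0, hty.eventually_const_lt hc] with n h1 h2
    exact (div_pos_iff_of_pos_right h1).1 h2
  have hd : Tendsto (fun n => Real.log (y (t n)) - Real.log (t n)) atTop (𝓝 (Real.log c)) := by
    refine hlog.congr' ?_
    filter_upwards [ht0, hy0] with n h1 h2
    exact Real.log_div h2.ne' h1.ne'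
  have h1 := (tendsto_sub_of_translation_tendsto hm hh
    (Real.tendsto_log_atTop.comp ht) hd).rexp
  rw [Real.exp_zero] at h1
  refine h1.congr' ?_
  filter_upwards [ht0, hy0] with n h1 h2
  have e1 := hl.pos _ h1
  have e2 := hl.pos _ h2
  simp only [hh_def, Function.comp, Real.exp_log h1, Real.exp_log h2]
  rw [Real.exp_sub, Real.exp_log e1, Real.exp_log e2]

theorem tendsto_regularlyVarying_div {l : ℝ → ℝ} (hl : IsSlowlyVarying l) {w : ℕ → ℝ} {β : ℝ}
    (hw : w ~[atTop] fun n : ℕ => (n : ℝ) ^ β * l n) {k : ℝ → ℕ} {c : ℝ} (hc : 0 < c)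
    (hk : Tendsto (fun t : ℝ => (k t : ℝ) / t) atTop (𝓝 c)) :
    Tendsto (fun t : ℝ => w (k t) / (t ^ β * l t)) atTop (𝓝 (c ^ β)) := by
  have hk0 : ∀ᶠ t : ℝ in atTop, 0 < (k t : ℝ) := by
    filter_upwards [eventually_gt_atTop 0, hk.eventually_const_lt hc] with t h1 h2
    exact (div_pos_iff_of_pos_right h1).1 h2
  have hkt : Tendsto k atTop atTop := by
    have : Tendsto (fun t : ℝ => (k t : ℝ)) atTop atTop := by
      refine (hk.pos_mul_atTop hc tendsto_id).congr' ?_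
      filter_upwards [eventually_gt_atTop 0] with t h1
      simp only [id]; field_simp
    exact tendsto_natCast_atTop_iff.1 this
  have hne : ∀ᶠ n : ℕ in atTop, (n : ℝ) ^ β * l n ≠ 0 := by
    filter_upwards [eventually_gt_atTop 0] with n hn
    have : (0 : ℝ) < n := by exact_mod_cast hn
    exact (mul_pos (Real.rpow_pos_of_pos this _) (hl.pos _ this)).ne'
  have h1 := ((isEquivalent_iff_tendsto_one hne).1 hw).comp hkt
  have h2 := hl.tendsto_div_of_tendsto_div hc hk
  have h3 : Tendsto (fun t : ℝ => ((k t : ℝ) / t) ^ β) atTop (𝓝 (c ^ β)) :=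
    hk.rpow_const (Or.inl hc.ne')
  have h4 := (h1.mul h2).mul h3
  rw [one_mul, one_mul] at h4
  refine h4.congr' ?_
  filter_upwards [eventually_gt_atTop 0, hk0] with t ht h0
  have e1 := hl.pos _ ht
  have e2 := hl.pos _ h0
  have e3 := Real.rpow_pos_of_pos h0 β
  have e4 := Real.rpow_pos_of_pos ht β
  simp only [Function.comp, Pi.div_apply]
  rw [Real.div_rpow h0.le ht.le]
  field_simp

theorem tendsto_regularlyVarying_div_floor {l : ℝ → ℝ} (hl : IsSlowlyVarying l) {w : ℕ → ℝ}
    {β : ℝ} (hw : w ~[atTop] fun n : ℕ => (n : ℝ) ^ β * l n) {k : ℝ → ℕ} {c : ℝ} (hc : 0 < c)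
    (hk : Tendsto (fun t : ℝ => (k t : ℝ) / t) atTop (𝓝 c)) :
    Tendsto (fun t : ℝ => w (k t) / w ⌊t⌋₊) atTop (𝓝 (c ^ β)) := by
  have h1 := tendsto_regularlyVarying_div hl hw one_pos tendsto_nat_floor_div_atTop
  have h2 := (tendsto_regularlyVarying_div hl hw hc hk).div h1 (by simp)
  rw [Real.one_rpow, div_one] at h2
  refine h2.congr' ?_
  filter_upwards [eventually_gt_atTop 0] with t ht
  have e1 := hl.pos _ ht
  have e4 := Real.rpow_pos_of_pos ht β
  simp only [Pi.div_apply]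
  exact div_div_div_cancel_right₀ (mul_pos e4 e1).ne' _ _

/-- Abel summation of a power series in `e^{-s}`, in integral form. -/
theorem tsum_exp_mul_eq_integral {d : ℕ → ℝ} {M s : ℝ} (hd : ∀ n, 0 ≤ d n) (hM : ∀ n, d n ≤ M)
    (hs : 0 < s) :
    ∑' n : ℕ, Real.exp (-(n * s)) * d n =
      ∫ x in Ioi (0 : ℝ), Real.exp (-x) * ∑ k ∈ Finset.range (⌊x / s⌋₊ + 1), d k := by
  set F : ℕ → ℝ → ℝ := fun n => (Ioi (n * s)).indicator fun x => Real.exp (-x) * d n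
  have hint : ∀ n : ℕ, IntegrableOn (fun x => Real.exp (-x) * d n) (Ioi (n * s)) := fun n =>
    (integrableOn_exp_neg_Ioi (n * s)).mul_const _
  have hFint : ∀ n, Integrable (F n) (volume.restrict (Ioi 0)) := fun n =>
    ((hint n).integrable_indicator measurableSet_Ioi).restrict
  have hF : ∀ n, ∫ x in Ioi (0 : ℝ), F n x = Real.exp (-(n * s)) * d n := by
    intro n
    rw [setIntegral_indicator measurableSet_Ioi, Ioi_inter_Ioi, max_eq_right (by positivity),
      integral_mul_const, integral_exp_neg_Ioi]
  have hFn : ∀ n x, 0 ≤ F n x := fun n x =>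
    indicator_nonneg (fun _ _ => mul_nonneg (Real.exp_pos _).le (hd n)) _
  have hsum : Summable fun n : ℕ => Real.exp (-(n * s)) * d n := by
    have hg : Summable fun n : ℕ => Real.exp (-s) ^ n * M :=
      (summable_geometric_of_lt_one (Real.exp_pos _).le (by simpa using hs)).mul_right M
    refine hg.of_nonneg_of_le (fun n => mul_nonneg (Real.exp_pos _).le (hd n)) fun n => ?_
    rw [← Real.exp_nat_mul, mul_neg]
    exact mul_le_mul_of_nonneg_left (hM n) (Real.exp_pos _).le
  have h1 := hasSum_integral_of_summable_integral_norm hFint (by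
    simpa only [Real.norm_of_nonneg (hFn _ _), hF] using hsum)
  simp only [hF] at h1
  rw [h1.tsum_eq]
  refine integral_congr_ae ?_
  -- Off the null set `ℕ * s` the series is the finite sum over `k ≤ x / s`.
  have hnull : ∀ᵐ x : ℝ ∂volume.restrict (Ioi 0), ∀ n : ℕ, x ≠ n * s :=
    ae_restrict_of_ae (ae_all_iff.2 fun n => Measure.ae_ne volume _)
  filter_upwards [hnull, ae_restrict_mem measurableSet_Ioi] with x hx hx0
  have hx0 : 0 < x := hx0
  have hiff : ∀ n : ℕ, n ∈ Finset.range (⌊x / s⌋₊ + 1) ↔ x ∈ Ioi (n * s) := by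
    intro n
    rw [Finset.mem_range, Nat.lt_succ_iff, Nat.le_floor_iff (by positivity), le_div_iff₀ hs,
      mem_Ioi, lt_iff_le_and_ne]
    exact ⟨fun h => ⟨h, (hx n).symm⟩, fun h => h.1⟩
  rw [tsum_eq_sum (s := Finset.range (⌊x / s⌋₊ + 1)), Finset.mul_sum]
  · exact Finset.sum_congr rfl fun n hn => indicator_of_mem ((hiff n).1 hn) _
  · intro n hn
    exact indicator_of_notMem (fun h => hn ((hiff n).2 h)) _

end InfiniteErgodic

namespace InfiniteErgodic

/-! ### From sum bounds to pointwise asymptotics -/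

theorem tendsto_floor_mul_natCast_div {c : ℝ} (hc : 0 ≤ c) :
    Tendsto (fun n : ℕ => (⌊c * n⌋₊ : ℝ) / n) atTop (𝓝 c) :=
  (tendsto_nat_floor_mul_div_atTop hc).comp tendsto_natCast_atTop_atTop

/-- The relations between a sequence `w`, thresholds `m` and, for each threshold `m n`, an antitone
sequence `p n` which together pin down the growth of the partial sums of `p n`. In the application
`w` is the wandering rate and `p n i` is the measure of the points of `Y` with fewer than `m n`
returns to `Y` up to time `i`. -/
structure SumBounds (w : ℕ → ℝ) (C : ℝ) (m : ℕ → ℝ) (p : ℕ → ℕ → ℝ) : Prop where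
  nonneg : ∀ n i, 0 ≤ p n i
  antitone : ∀ n, Antitone (p n)
  sum_le : ∀ n j, ∑ i ∈ Finset.range j, p n i ≤ m n * w j
  le_sum : ∀ n j i, 1 ≤ j → m n * w j * (1 - C * p n i) ≤ ∑ k ∈ Finset.range (j + i), p n k

variable {w : ℕ → ℝ} {β C : ℝ} {m : ℕ → ℝ} {p : ℕ → ℕ → ℝ}

theorem SumBounds.tendsto_zero (hp : SumBounds w C m p) (hw0 : ∀ n, 1 ≤ n → 0 < w n)
    (hw : ∀ x : ℝ, 0 < x → Tendsto (fun n : ℕ => w ⌊x * n⌋₊ / w n) atTop (𝓝 (x ^ β)))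
    (hm : Tendsto (fun n : ℕ => m n * w n / n) atTop (𝓝 0)) {x : ℝ} (hx : 0 < x) :
    Tendsto (fun n : ℕ => p n ⌊x * n⌋₊) atTop (𝓝 0) := by
  have h1 := (hm.mul (hw x hx)).div (tendsto_floor_mul_natCast_div hx.le) hx.ne'
  rw [zero_mul, zero_div] at h1
  refine squeeze_zero' (Eventually.of_forall fun n => hp.nonneg _ _) ?_ h1
  filter_upwards [eventually_ge_atTop 1,
    (tendsto_floor_mul_natCast_div hx.le).eventually_const_lt hx] with n hn hk
  have hn0 : (0 : ℝ) < n := by exact_mod_cast hn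
  have hk0 : (0 : ℝ) < ⌊x * n⌋₊ := (div_pos_iff_of_pos_right hn0).1 hk
  have h2 := hp.sum_le n ⌊x * n⌋₊
  have h3 : (⌊x * n⌋₊ : ℝ) * p n ⌊x * n⌋₊ ≤ ∑ i ∈ Finset.range ⌊x * n⌋₊, p n i := by
    have := Finset.card_nsmul_le_sum (Finset.range ⌊x * n⌋₊) (p n) (p n ⌊x * n⌋₊)
      fun i hi => hp.antitone n (Finset.mem_range.1 hi).le
    simpa using this
  have hwn := hw0 n hn
  simp only [Pi.div_apply]
  rw [show m n * w n / n * (w ⌊x * n⌋₊ / w n) / (⌊x * n⌋₊ / n) = m n * w ⌊x * n⌋₊ / ⌊x * n⌋₊ by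
    field_simp, le_div_iff₀ hk0]
  linarith

/-- The partial sums of `p n` grow like `m n * w`: the upper bound is `SumBounds.sum_le`, and in the
lower bound the error factor `1 - C * p n i` tends to `1`. -/
theorem SumBounds.tendsto_sum (hp : SumBounds w C m p)
    (hw0 : ∀ n, 1 ≤ n → 0 < w n) (hm0 : ∀ n, 0 < m n)
    (hw : ∀ x : ℝ, 0 < x → Tendsto (fun n : ℕ => w ⌊x * n⌋₊ / w n) atTop (𝓝 (x ^ β)))
    (hm : Tendsto (fun n : ℕ => m n * w n / n) atTop (𝓝 0)) {x : ℝ} (hx : 0 < x) :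
    Tendsto (fun n : ℕ => (∑ i ∈ Finset.range ⌊x * n⌋₊, p n i) / (m n * w n)) atTop
      (𝓝 (x ^ β)) := by
  rw [tendsto_order]
  constructor
  · intro b hb
    -- In `le_sum` take `j = ⌊y n⌋` and `i = ⌊(x - y) n⌋`, which leaves `p n i` a time of order `n`
    -- to become small; `y` close to `x` makes the loss `w j / w ⌊x n⌋` arbitrarily small.
    obtain ⟨y, hy0, hyx, hby⟩ : ∃ y, 0 < y ∧ y < x ∧ b < y ^ β := by
      have hcont : ContinuousAt (fun y : ℝ => y ^ β) x :=
        Real.continuousAt_rpow_const _ _ (Or.inl hx.ne')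
      have h1 : ∀ᶠ y in 𝓝[<] x, b < y ^ β :=
        (hcont.eventually_const_lt hb).filter_mono nhdsWithin_le_nhds
      have h2 : ∀ᶠ y in 𝓝[<] x, y ∈ Ioo 0 x := Ioo_mem_nhdsLT hx
      obtain ⟨y, h3, h4⟩ := (h1.and h2).exists
      exact ⟨y, h4.1, h4.2, h3⟩
    have hz := hp.tendsto_zero hw0 hw hm (sub_pos.2 hyx)
    have h1 := (hw y hy0).mul ((hz.const_mul C).const_sub 1)
    rw [mul_zero, sub_zero, mul_one] at h1
    filter_upwards [h1.eventually_const_lt hby, eventually_ge_atTop 1,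
      (tendsto_floor_mul_natCast_div hy0.le).eventually_const_lt hy0] with n hn1 hn hk
    have hn0 : (0 : ℝ) < n := by exact_mod_cast hn
    have hk0 : (0 : ℝ) < ⌊y * n⌋₊ := (div_pos_iff_of_pos_right hn0).1 hk
    refine hn1.trans_le ?_
    have h2 := hp.le_sum n ⌊y * n⌋₊ ⌊(x - y) * n⌋₊ (by exact_mod_cast hk0)
    have h3 : ⌊y * n⌋₊ + ⌊(x - y) * n⌋₊ ≤ ⌊x * n⌋₊ := by
      refine (Nat.le_floor ?_)
      push_cast
      have e1 := Nat.floor_le (a := y * n) (by positivity)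
      have e2 := Nat.floor_le (a := (x - y) * n) (mul_nonneg (sub_pos.2 hyx).le hn0.le)
      linarith
    have h4 : ∑ i ∈ Finset.range (⌊y * n⌋₊ + ⌊(x - y) * n⌋₊), p n i ≤
        ∑ i ∈ Finset.range ⌊x * n⌋₊, p n i :=
      Finset.sum_le_sum_of_subset_of_nonneg (Finset.range_mono h3) fun i _ _ => hp.nonneg _ _
    have hwn := hw0 n hn
    have hmn := hm0 n
    rw [le_div_iff₀ (mul_pos hmn hwn)]
    refine le_trans (le_of_eq ?_) (h2.trans h4)
    field_simp
  · intro b hb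
    filter_upwards [(hw x hx).eventually_lt_const hb, eventually_ge_atTop 1] with n hn1 hn
    refine lt_of_le_of_lt ?_ hn1
    have hwn := hw0 n hn
    have hmn := hm0 n
    rw [div_le_div_iff₀ (mul_pos hmn hwn) hwn]
    have := mul_le_mul_of_nonneg_right (hp.sum_le n ⌊x * n⌋₊) hwn.le
    linarith

/-- The monotone density argument: `p n n` lies between the averages of `p n` over `[(1 - h) n, n)`
and over `[n, (1 + h) n)`, and these are difference quotients at `1` of `y ↦ y ^ β`. -/
theorem SumBounds.tendsto_density (hp : SumBounds w C m p)
    (hw0 : ∀ n, 1 ≤ n → 0 < w n) (hm0 : ∀ n, 0 < m n)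
    (hw : ∀ x : ℝ, 0 < x → Tendsto (fun n : ℕ => w ⌊x * n⌋₊ / w n) atTop (𝓝 (x ^ β)))
    (hm : Tendsto (fun n : ℕ => m n * w n / n) atTop (𝓝 0)) :
    Tendsto (fun n : ℕ => n * p n n / (m n * w n)) atTop (𝓝 β) := by
  have hS := fun {x : ℝ} (hx : 0 < x) => hp.tendsto_sum hw0 hm0 hw hm hx
  have hS1 := hS one_pos
  simp only [one_mul, Nat.floor_natCast, Real.one_rpow] at hS1
  have hslope : Tendsto (slope (fun y : ℝ => y ^ β) 1) (𝓝[≠] 1) (𝓝 β) := by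
    have := (Real.hasDerivAt_rpow_const (x := 1) (p := β) (Or.inl one_ne_zero)).tendsto_slope
    simpa using this
  rw [tendsto_order]
  constructor
  · intro b hb
    have h1 : ∀ᶠ y : ℝ in 𝓝[>] 1, b < slope (fun y : ℝ => y ^ β) 1 y :=
      (hslope.eventually_const_lt hb).filter_mono (nhdsWithin_mono _ fun y hy => ne_of_gt hy)
    obtain ⟨y, hy, hy1⟩ := (h1.and self_mem_nhdsWithin).exists
    have hy1 : 1 < y := hy1
    rw [slope_def_field, Real.one_rpow] at hy
    have h2 := ((hS (one_pos.trans hy1)).sub hS1).div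
      ((tendsto_floor_mul_natCast_div (c := y) (by linarith)).sub_const 1) (by linarith)
    filter_upwards [h2.eventually_const_lt hy, eventually_ge_atTop 1,
      (tendsto_floor_mul_natCast_div (c := y) (by linarith)).eventually_const_lt hy1] with n h3 hn h4
    refine h3.trans_le ?_
    have hn0 : (0 : ℝ) < n := by exact_mod_cast hn
    have hk : (n : ℝ) < ⌊y * n⌋₊ := by rwa [lt_div_iff₀ hn0, one_mul] at h4
    have hk' : n ≤ ⌊y * n⌋₊ := by exact_mod_cast hk.le
    have h5 : ∑ i ∈ Finset.range ⌊y * n⌋₊, p n i - ∑ i ∈ Finset.range n, p n i ≤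
        (⌊y * n⌋₊ - n) * p n n := by
      rw [← Finset.sum_Ico_eq_sub _ hk']
      have := Finset.sum_le_card_nsmul (Finset.Ico n ⌊y * n⌋₊) (p n) (p n n)
        fun i hi => hp.antitone n (Finset.mem_Ico.1 hi).1
      simpa [Nat.cast_sub hk'] using this
    have hwm := mul_pos (hm0 n) (hw0 n hn)
    simp only [Pi.div_apply]
    rw [← sub_div, div_sub_one hn0.ne', div_le_iff₀ (div_pos (sub_pos.2 hk) hn0),
      div_mul_div_comm, div_le_div_iff₀ hwm (mul_pos hwm hn0)]
    have := mul_le_mul_of_nonneg_right h5 (mul_pos hwm hn0).le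
    linarith
  · intro b hb
    have h1 : ∀ᶠ y : ℝ in 𝓝[<] 1, slope (fun y : ℝ => y ^ β) 1 y < b :=
      (hslope.eventually_lt_const hb).filter_mono (nhdsWithin_mono _ fun y hy => ne_of_lt hy)
    have h1' : ∀ᶠ y : ℝ in 𝓝[<] 1, y ∈ Ioo (0 : ℝ) 1 := Ioo_mem_nhdsLT one_pos
    obtain ⟨y, hy, hy0, hy1⟩ := (h1.and h1').exists
    rw [slope_comm, slope_def_field, Real.one_rpow] at hy
    have h2 := (hS1.sub (hS hy0)).div
      ((tendsto_floor_mul_natCast_div hy0.le).const_sub 1) (by linarith)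
    filter_upwards [h2.eventually_lt_const hy, eventually_ge_atTop 1,
      (tendsto_floor_mul_natCast_div hy0.le).eventually_lt_const hy1] with n h3 hn h4
    refine lt_of_le_of_lt ?_ h3
    have hn0 : (0 : ℝ) < n := by exact_mod_cast hn
    have hk : (⌊y * n⌋₊ : ℝ) < n := by rwa [div_lt_iff₀ hn0, one_mul] at h4
    have hk' : ⌊y * n⌋₊ ≤ n := by exact_mod_cast hk.le
    have h5 : (n - ⌊y * n⌋₊) * p n n ≤
        ∑ i ∈ Finset.range n, p n i - ∑ i ∈ Finset.range ⌊y * n⌋₊, p n i := by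
      rw [← Finset.sum_Ico_eq_sub _ hk']
      have := Finset.card_nsmul_le_sum (Finset.Ico ⌊y * n⌋₊ n) (p n) (p n n)
        fun i hi => hp.antitone n (Finset.mem_Ico.1 hi).2.le
      simpa [Nat.cast_sub hk'] using this
    have hwm := mul_pos (hm0 n) (hw0 n hn)
    simp only [Pi.div_apply]
    rw [← sub_div, one_sub_div hn0.ne', le_div_iff₀ (div_pos (sub_pos.2 hk) hn0),
      div_mul_div_comm, div_le_div_iff₀ (mul_pos hwm hn0) hwm]
    have := mul_le_mul_of_nonneg_right h5 (mul_pos hwm hn0).le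
    linarith

end InfiniteErgodic

namespace InfiniteErgodic

/-! ### Visits to `Y` and the wandering rate -/

variable {X : Type*} {T : X → X} {Y : Set X}

/-- The set `⋃_{k<n} T⁻ᵏ Y` of points which visit `Y` before time `n`. -/
abbrev visited (T : X → X) (Y : Set X) (n : ℕ) : Set X := ⋃ k ∈ Finset.range n, T^[k] ⁻¹' Y

theorem mem_visited {n : ℕ} {x : X} : x ∈ visited T Y n ↔ ∃ k < n, T^[k] x ∈ Y := by
  simp [visited]

theorem visited_mono : Monotone (visited T Y) := fun _ _ h _ hx => by
  rw [mem_visited] at hx ⊢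
  obtain ⟨k, hk, hx⟩ := hx
  exact ⟨k, hk.trans_le h, hx⟩

/-- The number of `k < n` with `Tᵏ x ∈ Y`; unlike in `occupationTime`, time `0` is counted. -/
noncomputable def visits (T : X → X) (Y : Set X) (n : ℕ) (x : X) : ℕ :=
  ∑ k ∈ Finset.range n, Y.indicator 1 (T^[k] x)

theorem visits_zero (x : X) : visits T Y 0 x = 0 := by simp [visits]

theorem visits_succ (n : ℕ) (x : X) :
    visits T Y (n + 1) x = visits T Y n (T x) + Y.indicator 1 x := by
  simp [visits, Finset.sum_range_succ']

theorem visits_mono (x : X) : Monotone fun n => visits T Y n x := fun _ _ h =>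
  Finset.sum_le_sum_of_subset (Finset.range_mono h)

theorem visits_add (k n : ℕ) (x : X) :
    visits T Y (k + n) x = visits T Y k x + visits T Y n (T^[k] x) := by
  simp only [visits, Finset.sum_range_add, ← Function.iterate_add_apply]
  simp only [add_comm k]

theorem visits_eq_zero {n : ℕ} {x : X} (hx : x ∉ visited T Y n) : visits T Y n x = 0 := by
  refine Finset.sum_eq_zero fun k hk => ?_
  exact indicator_of_notMem
    (fun h => hx (mem_visited.2 ⟨k, Finset.mem_range.1 hk, h⟩)) _

theorem occupationTime_eq_visits (n : ℕ) (x : X) :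
    occupationTime T Y n x = visits T Y n (T x) := by
  rw [occupationTime, visits, Nat.cast_sum, ← Finset.Ico_add_one_right_eq_Icc,
    Finset.sum_Ico_eq_sum_range]
  refine Finset.sum_congr (by simp) fun k _ => ?_
  by_cases h : T^[k] (T x) ∈ Y <;> simp [h, add_comm 1 k]

theorem exists_mem_firstVisit {n : ℕ} {x : X} (hx : x ∈ visited T Y n) :
    ∃ k < n, x ∈ firstVisit T Y k := by
  classical
  obtain ⟨k, hk, hxk⟩ := mem_visited.1 hx
  have hex : ∃ k, T^[k] x ∈ Y := ⟨k, hxk⟩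
  refine ⟨Nat.find hex, (Nat.find_min' hex hxk).trans_lt hk, Nat.find_spec hex, fun h => ?_⟩
  obtain ⟨j, hj, hxj⟩ := mem_visited.1 h
  exact Nat.find_min hex hj hxj

/-- The points of `Y` which return fewer than `m` times to `Y` up to time `i`. -/
def fewReturns (T : X → X) (Y : Set X) (m i : ℕ) : Set X := Y ∩ {x | visits T Y i (T x) < m}

theorem fewReturns_antitone (m : ℕ) : Antitone (fewReturns T Y m) := fun _ _ h x hx =>
  ⟨hx.1, (visits_mono (T x) h).trans_lt hx.2⟩

/-- The visit at time `j` contributes to the right-hand side if it is followed by fewer than `m`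
visits before time `n`, that is, if it is one of the last `m` visits. -/
theorem min_visits_eq_sum (m n : ℕ) (x : X) :
    min (visits T Y n x) m =
      ∑ j ∈ Finset.range n, (fewReturns T Y m (n - 1 - j)).indicator 1 (T^[j] x) := by
  classical
  induction n generalizing x with
  | zero => simp [visits_zero]
  | succ n ih =>
    rw [Finset.sum_range_succ', visits_succ]
    have h1 : ∑ j ∈ Finset.range n,
        (fewReturns T Y m (n + 1 - 1 - (j + 1))).indicator (1 : X → ℕ) (T^[j + 1] x) =
        min (visits T Y n (T x)) m := by
      rw [ih]
      refine Finset.sum_congr rfl fun j _ => ?_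
      rw [Function.iterate_succ_apply, show n + 1 - 1 - (j + 1) = n - 1 - j by omega]
    rw [h1]
    simp only [indicator, fewReturns, Function.iterate_zero, id, mem_inter_iff, mem_ofPred_eq,
      Pi.one_apply, Nat.add_sub_cancel, Nat.sub_zero]
    split_ifs <;> grind

variable [MeasurableSpace X] {μ : Measure X}

theorem measurableSet_visited (hT : Measurable T) (hY : MeasurableSet Y) (n : ℕ) :
    MeasurableSet (visited T Y n) :=
  Finset.measurableSet_biUnion _ fun k _ => hT.iterate k hY

theorem measurableSet_firstVisit (hT : Measurable T) (hY : MeasurableSet Y) (n : ℕ) :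
    MeasurableSet (firstVisit T Y n) :=
  (hT.iterate n hY).diff (measurableSet_visited hT hY n)

theorem measure_visited_lt_top (hT : MeasurePreserving T μ μ) (hY : MeasurableSet Y)
    (hfin : μ Y < ∞) (n : ℕ) : μ (visited T Y n) < ∞ := by
  refine (measure_biUnion_finset_le _ _).trans_lt (ENNReal.sum_lt_top.2 fun k _ => ?_)
  rwa [(hT.iterate k).measure_preimage hY.nullMeasurableSet]

theorem wanderingRate_zero : wanderingRate T μ Y 0 = 0 := by simp [wanderingRate]

theorem wanderingRate_mono (hT : MeasurePreserving T μ μ) (hY : MeasurableSet Y)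
    (hfin : μ Y < ∞) : Monotone (wanderingRate T μ Y) := fun _ n h =>
  measureReal_mono (visited_mono h) (measure_visited_lt_top hT hY hfin n).ne

theorem wanderingRate_pos (hT : MeasurePreserving T μ μ) (hY : MeasurableSet Y)
    (hpos : 0 < μ Y) (hfin : μ Y < ∞) {n : ℕ} (hn : 1 ≤ n) : 0 < wanderingRate T μ Y n := by
  refine lt_of_lt_of_le ?_ (wanderingRate_mono hT hY hfin hn)
  simpa [wanderingRate, measureReal_def] using ENNReal.toReal_pos hpos.ne' hfin.ne

theorem wanderingRate_add_le (hT : MeasurePreserving T μ μ) (hY : MeasurableSet Y)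
    (hfin : μ Y < ∞) (i j : ℕ) :
    wanderingRate T μ Y (i + j) ≤ wanderingRate T μ Y i + wanderingRate T μ Y j := by
  have hsub : visited T Y (i + j) ⊆ visited T Y i ∪ T^[i] ⁻¹' visited T Y j := by
    intro x hx
    obtain ⟨k, hk, hxk⟩ := mem_visited.1 hx
    rcases lt_or_ge k i with h | h
    · exact Or.inl (mem_visited.2 ⟨k, h, hxk⟩)
    · refine Or.inr (mem_visited.2 ⟨k - i, by omega, ?_⟩)
      rwa [← Function.iterate_add_apply, Nat.sub_add_cancel h]
  have hinv : μ (T^[i] ⁻¹' visited T Y j) = μ (visited T Y j) :=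
    (hT.iterate i).measure_preimage (measurableSet_visited hT.measurable hY j).nullMeasurableSet
  have hlt := measure_visited_lt_top hT hY hfin
  calc μ.real (visited T Y (i + j))
      ≤ μ.real (visited T Y i ∪ T^[i] ⁻¹' visited T Y j) :=
        measureReal_mono hsub (measure_union_lt_top (hlt i) (hinv ▸ hlt j)).ne
    _ ≤ μ.real (visited T Y i) + μ.real (T^[i] ⁻¹' visited T Y j) := measureReal_union_le _ _
    _ = _ := by rw [measureReal_def μ (T^[i] ⁻¹' _), hinv]; rfl

theorem wanderingRate_mul_le (hT : MeasurePreserving T μ μ) (hY : MeasurableSet Y)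
    (hfin : μ Y < ∞) (k n : ℕ) : wanderingRate T μ Y (k * n) ≤ k * wanderingRate T μ Y n := by
  induction k with
  | zero => simp [wanderingRate_zero]
  | succ k ih =>
    rw [Nat.succ_mul]
    push_cast
    linarith [wanderingRate_add_le hT hY hfin (k * n) n]

theorem measurable_visits (hT : Measurable T) (hY : MeasurableSet Y) (n : ℕ) :
    Measurable (visits T Y n) := by
  exact Finset.measurable_sum _ fun k _ => (measurable_one.indicator hY).comp (hT.iterate k)

theorem measurableSet_fewReturns (hT : Measurable T) (hY : MeasurableSet Y) (m i : ℕ) :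
    MeasurableSet (fewReturns T Y m i) :=
  hY.inter (measurableSet_lt ((measurable_visits hT hY i).comp hT) measurable_const)

/-! ### Bounds for the measure of points with few returns -/

theorem lintegral_min_visits (hT : MeasurePreserving T μ μ) (hY : MeasurableSet Y) (m n : ℕ) :
    ∫⁻ x, (min (visits T Y n x) m : ℕ) ∂μ =
      ∑ i ∈ Finset.range n, μ (fewReturns T Y m i) := by
  have hD := measurableSet_fewReturns hT.measurable hY m
  have h1 : ∀ x, ((min (visits T Y n x) m : ℕ) : ℝ≥0∞) =
      ∑ j ∈ Finset.range n, (T^[j] ⁻¹' fewReturns T Y m (n - 1 - j)).indicator 1 x := by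
    intro x
    classical
    rw [min_visits_eq_sum]
    push_cast
    refine Finset.sum_congr rfl fun j _ => ?_
    simp only [indicator, mem_preimage, Pi.one_apply]
    split_ifs <;> simp
  simp only [h1]
  rw [lintegral_finsetSum _ fun j _ => measurable_one.indicator (hT.measurable.iterate j (hD _)),
    ← Finset.sum_range_reflect (fun i => μ (fewReturns T Y m i))]
  refine Finset.sum_congr rfl fun j _ => ?_
  rw [lintegral_indicator_one (hT.measurable.iterate j (hD _)),
    (hT.iterate j).measure_preimage (hD _).nullMeasurableSet]

theorem sum_measure_fewReturns_le (hT : MeasurePreserving T μ μ) (hY : MeasurableSet Y)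
    (m n : ℕ) :
    ∑ i ∈ Finset.range n, μ (fewReturns T Y m i) ≤ m * μ (visited T Y n) := by
  rw [← lintegral_min_visits hT hY,
    ← lintegral_indicator_const (measurableSet_visited hT.measurable hY n)]
  refine lintegral_mono fun x => ?_
  by_cases hx : x ∈ visited T Y n
  · rw [indicator_of_mem hx]
    exact Nat.cast_le.2 (min_le_right _ _)
  · simp [visits_eq_zero hx]

/-- A point which visits `Y` before time `j` either has at least `m` visits before time `j + i`, or
has few returns after its first visit; the second alternative is the sum over `k`. -/
theorem mul_measure_visited_le (hT : MeasurePreserving T μ μ) (hY : MeasurableSet Y)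
    (m j i : ℕ) :
    m * μ (visited T Y j) ≤ ∑ k ∈ Finset.range (j + i), μ (fewReturns T Y m k) +
      m * ∑ k ∈ Finset.range j, μ (firstVisit T Y k ∩ T^[k] ⁻¹' fewReturns T Y m i) := by
  have hE : ∀ k, MeasurableSet (firstVisit T Y k ∩ T^[k] ⁻¹' fewReturns T Y m i) := fun k =>
    (measurableSet_firstVisit hT.measurable hY k).inter
      (hT.measurable.iterate k (measurableSet_fewReturns hT.measurable hY m i))
  have hV : Measurable fun x => ((min (visits T Y (j + i) x) m : ℕ) : ℝ≥0∞) :=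
    measurable_from_nat.comp ((measurable_visits hT.measurable hY _).min measurable_const)
  rw [← lintegral_min_visits hT hY,
    ← lintegral_indicator_const (measurableSet_visited hT.measurable hY j), Finset.mul_sum]
  simp_rw [← lintegral_indicator_const (hE _)]
  rw [← lintegral_finsetSum _ fun k _ => measurable_const.indicator (hE k), ← lintegral_add_left hV]
  refine lintegral_mono fun x => ?_
  by_cases hx : x ∈ visited T Y j
  swap
  · simp [indicator_of_notMem hx]
  rw [indicator_of_mem hx]
  by_cases hm : m ≤ visits T Y (j + i) x
  · rw [min_eq_right hm]
    exact le_self_add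
  -- Since `k < j`, there are at least `i` time steps left after the first visit at time `k`.
  obtain ⟨k, hk, hxk⟩ := exists_mem_firstVisit hx
  have hmem : x ∈ firstVisit T Y k ∩ T^[k] ⁻¹' fewReturns T Y m i := by
    refine ⟨hxk, hxk.1, ?_⟩
    have h1 := visits_mono (T := T) (Y := Y) x (show (k + 1) + i ≤ j + i by omega)
    simp only [visits_add, Function.iterate_succ_apply'] at h1
    simp only [mem_ofPred_eq]
    simp only [visits_add] at hm
    omega
  have h2 := Finset.single_le_sum
    (f := fun k => (firstVisit T Y k ∩ T^[k] ⁻¹' fewReturns T Y m i).indicator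
      (fun _ => (m : ℝ≥0∞)) x) (fun _ _ => bot_le) (Finset.mem_range.2 hk)
  simp only [indicator_of_mem hmem] at h2
  exact h2.trans le_add_self

/-! ### Transfer operator and entrance sums -/

/-- Integrability of `u` makes the image measures finite, so that the Radon–Nikodym derivatives in
the definition of `transfer` are genuine densities. -/
theorem withDensity_iterate_transfer [SigmaFinite μ] (hT : MeasurePreserving T μ μ)
    {u : X → ℝ≥0∞} (hu : ∫⁻ x, u x ∂μ ≠ ∞) (k : ℕ) :
    μ.withDensity ((transfer T μ)^[k] u) = (μ.withDensity u).map T^[k] := by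
  induction k with
  | zero => simp
  | succ k ih =>
    have := isFiniteMeasure_withDensity hu
    have hac : ((μ.withDensity u).map T^[k]).map T ≪ μ := by
      have h1 : (μ.withDensity u).map T^[k] ≪ μ :=
        ((withDensity_absolutelyContinuous μ u).map (hT.iterate k).measurable).trans
          (hT.iterate k).map_eq.absolutelyContinuous
      exact (h1.map hT.measurable).trans hT.map_eq.absolutelyContinuous
    rw [Function.iterate_succ_apply', transfer, ih, Measure.withDensity_rnDeriv_eq _ _ hac,
      Measure.map_map hT.measurable (hT.iterate k).measurable, ← Function.iterate_succ']

theorem measure_firstVisit_inter_preimage [SigmaFinite μ] (hT : MeasurePreserving T μ μ)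
    (hY : MeasurableSet Y) (hfin : μ Y < ∞) {D : Set X} (hD : MeasurableSet D) (k : ℕ) :
    μ (firstVisit T Y k ∩ T^[k] ⁻¹' D) =
      ∫⁻ x in D, (transfer T μ)^[k] ((firstVisit T Y k).indicator 1) x ∂μ := by
  have hm := measurableSet_firstVisit hT.measurable hY k
  have hu : ∫⁻ x, (firstVisit T Y k).indicator 1 x ∂μ ≠ ∞ := by
    rw [lintegral_indicator_one hm]
    refine ((measure_mono sdiff_subset).trans_lt ?_).ne
    rwa [(hT.iterate k).measure_preimage hY.nullMeasurableSet]
  rw [← withDensity_apply _ hD, withDensity_iterate_transfer hT hu,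
    Measure.map_apply (hT.iterate k).measurable hD, withDensity_indicator_one hm,
    Measure.restrict_apply (hT.measurable.iterate k hD), inter_comm]

theorem sum_measure_firstVisit_inter_preimage_le [SigmaFinite μ] (hT : MeasurePreserving T μ μ)
    (hY : MeasurableSet Y) (hpos : 0 < μ Y) (hfin : μ Y < ∞) {C : ℝ≥0} {j : ℕ} (hj : 1 ≤ j)
    (hC : eLpNorm (entranceMean T μ Y j) ∞ μ ≤ C) {D : Set X} (hD : MeasurableSet D) :
    ∑ k ∈ Finset.range j, μ (firstVisit T Y k ∩ T^[k] ⁻¹' D) ≤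
      C * μ (visited T Y j) * μ D := by
  have hw : ENNReal.ofReal (wanderingRate T μ Y j) = μ (visited T Y j) :=
    ENNReal.ofReal_toReal (measure_visited_lt_top hT hY hfin j).ne
  have hw0 : μ (visited T Y j) ≠ 0 := by
    rw [← hw]
    exact (ENNReal.ofReal_pos.2 (wanderingRate_pos hT hY hpos hfin hj)).ne'
  have hbd : ∀ᵐ x ∂μ, ∑ k ∈ Finset.range j,
      (transfer T μ)^[k] ((firstVisit T Y k).indicator 1) x ≤ C * μ (visited T Y j) := by
    rw [eLpNorm_exponent_top] at hC
    filter_upwards [ae_le_eLpNormEssSup (f := entranceMean T μ Y j) (μ := μ)] with x hx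
    have h1 := hx.trans hC
    rw [enorm_eq_self, entranceMean, hw] at h1
    rwa [ENNReal.div_le_iff hw0 (measure_visited_lt_top hT hY hfin j).ne] at h1
  have hmeas : ∀ k, Measurable ((transfer T μ)^[k] ((firstVisit T Y k).indicator 1)) := by
    intro k
    cases k with
    | zero => exact measurable_one.indicator (measurableSet_firstVisit hT.measurable hY 0)
    | succ k =>
      rw [Function.iterate_succ_apply']
      exact Measure.measurable_rnDeriv _ _
  simp_rw [measure_firstVisit_inter_preimage hT hY hfin hD]
  rw [← lintegral_finsetSum _ fun k _ => hmeas k]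
  refine (lintegral_mono_ae (ae_restrict_of_ae hbd)).trans ?_
  rw [setLIntegral_const]

end InfiniteErgodic

namespace InfiniteErgodic

variable {X : Type*} [MeasurableSpace X] {μ : Measure X} {T : X → X} {Y : Set X}

theorem sumBounds_fewReturns [SigmaFinite μ] (hT : MeasurePreserving T μ μ)
    (hY : MeasurableSet Y) (hpos : 0 < μ Y) (hfin : μ Y < ∞) {C : ℝ≥0}
    (hC : ∀ n : ℕ, 1 ≤ n → eLpNorm (entranceMean T μ Y n) ∞ μ ≤ C) (m : ℕ → ℕ) :
    SumBounds (wanderingRate T μ Y) C (fun n => m n)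
      fun n i => μ.real (fewReturns T Y (m n) i) := by
  have hD : ∀ m i, μ (fewReturns T Y m i) ≠ ∞ := fun m i =>
    ((measure_mono inter_subset_left).trans_lt hfin).ne
  have hV := fun n => (measure_visited_lt_top hT hY hfin n).ne
  have hsum : ∀ m j, ∑ i ∈ Finset.range j, μ.real (fewReturns T Y m i) =
      (∑ i ∈ Finset.range j, μ (fewReturns T Y m i)).toReal := fun m j =>
    (ENNReal.toReal_sum fun i _ => hD m i).symm
  refine ⟨fun n i => measureReal_nonneg,
    fun n _ _ h => measureReal_mono (fewReturns_antitone _ h) (hD _ _), fun n j => ?_,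
    fun n j i hj => ?_⟩
  · rw [hsum]
    have := ENNReal.toReal_mono (ENNReal.mul_ne_top (ENNReal.natCast_ne_top _) (hV j))
      (sum_measure_fewReturns_le hT hY (m n) j)
    rwa [ENNReal.toReal_mul, ENNReal.toReal_natCast] at this
  · have h1 := mul_measure_visited_le hT hY (m n) j i
    have h2 := sum_measure_firstVisit_inter_preimage_le hT hY hpos hfin hj (hC j hj)
      (measurableSet_fewReturns hT.measurable hY (m n) i)
    have h3 := h1.trans (add_le_add_right (mul_le_mul_right h2 _) _)
    have hS : ∑ i ∈ Finset.range (j + i), μ (fewReturns T Y (m n) i) ≠ ∞ :=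
      ENNReal.sum_ne_top.2 fun i _ => hD _ _
    have hP : (m n : ℝ≥0∞) * (C * μ (visited T Y j) * μ (fewReturns T Y (m n) i)) ≠ ∞ :=
      ENNReal.mul_ne_top (ENNReal.natCast_ne_top _)
        (ENNReal.mul_ne_top (ENNReal.mul_ne_top ENNReal.coe_ne_top (hV j)) (hD _ _))
    have h4 := ENNReal.toReal_mono (ENNReal.add_ne_top.2 ⟨hS, hP⟩) h3
    rw [ENNReal.toReal_add hS hP, ← hsum] at h4
    simp only [ENNReal.toReal_mul, ENNReal.toReal_natCast, ENNReal.coe_toReal] at h4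
    simp only [wanderingRate, measureReal_def] at h4 ⊢
    linarith

/-! ### Asymptotics of the normalizer -/

theorem wanderingLaplace_eq_integral (hT : MeasurePreserving T μ μ) (hY : MeasurableSet Y)
    (hfin : μ Y < ∞) {t : ℝ} (ht : 0 < t) :
    wanderingLaplace T μ Y t⁻¹ =
      ∫ x in Ioi (0 : ℝ), Real.exp (-x) * wanderingRate T μ Y (⌊x * t⌋₊ + 1) := by
  have h1 := tsum_exp_mul_eq_integral (s := t⁻¹) (M := wanderingRate T μ Y 1)
    (d := fun n => wanderingRate T μ Y (n + 1) - wanderingRate T μ Y n)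
    (fun n => sub_nonneg.2 (wanderingRate_mono hT hY hfin n.le_succ))
    (fun n => by linarith [wanderingRate_add_le hT hY hfin n 1]) (inv_pos.2 ht)
  rw [wanderingLaplace, h1]
  simp only [Finset.sum_range_sub, wanderingRate_zero, sub_zero, div_inv_eq_mul]

/-- The integrand of `wanderingLaplace_eq_integral`, divided by `w ⌊t⌋`, converges to
`e^{-x} x ^ β`, and subadditivity of `w` dominates it. -/
theorem tendsto_wanderingLaplace_div (hT : MeasurePreserving T μ μ) (hY : MeasurableSet Y)
    (hpos : 0 < μ Y) (hfin : μ Y < ∞) {β : ℝ} (hβ : 0 < β) {l : ℝ → ℝ}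
    (hl : IsSlowlyVarying l)
    (hw : (fun n : ℕ => wanderingRate T μ Y n) ~[atTop] fun n : ℕ => (n : ℝ) ^ β * l n) :
    Tendsto (fun t : ℝ => wanderingLaplace T μ Y t⁻¹ / wanderingRate T μ Y ⌊t⌋₊) atTop
      (𝓝 (Real.Gamma (1 + β))) := by
  have hmono := wanderingRate_mono hT hY hfin
  have hlim : Tendsto (fun t : ℝ => ∫ x in Ioi (0 : ℝ),
      Real.exp (-x) * (wanderingRate T μ Y (⌊x * t⌋₊ + 1) / wanderingRate T μ Y ⌊t⌋₊)) atTop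
      (𝓝 (∫ x in Ioi (0 : ℝ), Real.exp (-x) * x ^ β)) := by
    refine tendsto_integral_filter_of_dominated_convergence
      (fun x => Real.exp (-x) * (2 * x + 2)) ?_ ?_ ?_ ?_
    · refine Eventually.of_forall fun t => Measurable.aestronglyMeasurable ?_
      have : Measurable fun x : ℝ => wanderingRate T μ Y (⌊x * t⌋₊ + 1) :=
        (measurable_from_nat (f := fun n => wanderingRate T μ Y (n + 1))).comp
          (Nat.measurable_floor.comp (measurable_id.mul_const t))
      exact (Real.measurable_exp.comp measurable_neg).mul (this.div_const _)
    · -- Subadditivity of the wandering rate gives a linear bound on the quotient.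
      filter_upwards [eventually_ge_atTop 1] with t ht
      filter_upwards [ae_restrict_mem measurableSet_Ioi] with x hx
      have hx : 0 < x := hx
      have hfl : 1 ≤ ⌊t⌋₊ := Nat.one_le_floor_iff _ |>.2 ht
      have hw0 := wanderingRate_pos hT hY hpos hfin hfl
      have hw1 := wanderingRate_pos hT hY hpos hfin (n := ⌊x * t⌋₊ + 1) (by omega)
      rw [Real.norm_of_nonneg (by positivity)]
      refine mul_le_mul_of_nonneg_left ?_ (Real.exp_pos _).le
      rw [div_le_iff₀ hw0]
      have hk : ⌊x * t⌋₊ + 1 ≤ (⌈2 * x⌉₊ + 1) * ⌊t⌋₊ := by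
        have e1 := Nat.floor_le (a := x * t) (by positivity)
        have e2 := Nat.lt_floor_add_one t
        have e3 := Nat.le_ceil (2 * x)
        have e4 : (1 : ℝ) ≤ ⌊t⌋₊ := by exact_mod_cast hfl
        have e5 : x * t ≤ 2 * x * ⌊t⌋₊ := by nlinarith
        have e6 : 2 * x * ⌊t⌋₊ ≤ ⌈2 * x⌉₊ * (⌊t⌋₊ : ℝ) := by gcongr
        have : ((⌊x * t⌋₊ + 1 : ℕ) : ℝ) ≤ ((⌈2 * x⌉₊ + 1) * ⌊t⌋₊ : ℕ) := by
          push_cast; linarith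
        exact_mod_cast this
      refine ((hmono hk).trans (wanderingRate_mul_le hT hY hfin _ _)).trans ?_
      refine mul_le_mul_of_nonneg_right ?_ hw0.le
      push_cast
      linarith [Nat.ceil_lt_add_one (a := 2 * x) (by positivity)]
    · have h1 : IntegrableOn (fun x : ℝ => Real.exp (-x) * x ^ ((2 : ℝ) - 1)) (Ioi 0) :=
        Real.GammaIntegral_convergent two_pos
      have h2 : IntegrableOn (fun x : ℝ => Real.exp (-x)) (Ioi 0) := integrableOn_exp_neg_Ioi 0
      refine ((h1.const_mul 2).add (h2.const_mul 2)).congr (ae_of_all _ fun x => ?_)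
      simp only [Pi.add_apply]
      rw [show (2 : ℝ) - 1 = 1 by norm_num, Real.rpow_one]
      ring
    · filter_upwards [ae_restrict_mem measurableSet_Ioi] with x hx
      have hx : 0 < x := hx
      refine Tendsto.const_mul _ (tendsto_regularlyVarying_div_floor hl hw hx ?_)
      have h1 := (tendsto_nat_floor_mul_div_atTop (R := ℝ) hx.le).add tendsto_inv_atTop_zero
      rw [add_zero] at h1
      refine h1.congr fun t => ?_
      push_cast
      rw [add_div, one_div]
  have hG : Real.Gamma (1 + β) = ∫ x in Ioi (0 : ℝ), Real.exp (-x) * x ^ β := by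
    rw [Real.Gamma_eq_integral (by linarith), add_sub_cancel_left]
  rw [hG]
  refine hlim.congr' ?_
  filter_upwards [eventually_gt_atTop 0] with t ht
  rw [wanderingLaplace_eq_integral hT hY hfin ht, ← integral_div]
  simp only [mul_div_assoc]

theorem normalizer_isEquivalent {α : ℝ} {l : ℝ → ℝ} (hα : α ∈ Ioo (0 : ℝ) 1)
    (hl : IsSlowlyVarying l) {w : ℕ → ℝ} (hw : w ~[atTop] fun n : ℕ => (n : ℝ) ^ (1 - α) * l n)
    (hQ : Tendsto (fun t : ℝ => wanderingLaplace T μ Y t⁻¹ / w ⌊t⌋₊) atTop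
      (𝓝 (Real.Gamma (2 - α)))) :
    (fun t : ℝ => normalizer T μ Y α t) ~[atTop]
      (fun t : ℝ => t ^ α / (Real.Gamma (1 + α) * Real.Gamma (2 - α) * l t)) := by
  have hG1 : 0 < Real.Gamma (1 + α) := Real.Gamma_pos_of_pos (by linarith [hα.1])
  have hG2 : 0 < Real.Gamma (2 - α) := Real.Gamma_pos_of_pos (by linarith [hα.2])
  have hR := tendsto_regularlyVarying_div hl hw one_pos tendsto_nat_floor_div_atTop
  rw [Real.one_rpow] at hR
  refine (isEquivalent_iff_tendsto_one ?_).2 ?_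
  · filter_upwards [eventually_gt_atTop 0] with t ht
    have := hl.pos t ht
    positivity
  have h1 := ((hQ.mul hR).inv₀ (by simpa using hG2.ne')).const_mul (Real.Gamma (2 - α))
  rw [mul_one, mul_inv_cancel₀ hG2.ne'] at h1
  refine h1.congr' ?_
  filter_upwards [eventually_gt_atTop 0, hR.eventually_const_lt one_pos] with t ht hR0
  have e1 := hl.pos t ht
  have e2 : w ⌊t⌋₊ ≠ 0 := by
    intro h
    simp [h] at hR0
  have e3 : t ^ α * t ^ (1 - α) = t := by
    rw [← Real.rpow_add ht]; simp
  have e4 := Real.rpow_pos_of_pos ht α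
  have e5 := Real.rpow_pos_of_pos ht (1 - α)
  simp only [Pi.div_apply, normalizer]
  generalize wanderingLaplace T μ Y t⁻¹ = q
  generalize w ⌊t⌋₊ = v at e2 ⊢
  generalize l t = L at e1 ⊢
  generalize t ^ (1 - α) = A at e3 e5 ⊢
  generalize t ^ α = B at e3 e4 ⊢
  rw [← e3]
  field_simp

end InfiniteErgodic

/-! ### The lower tail of the occupation time -/

open InfiniteErgodic

theorem mainTheorem2 {X : Type*} [MeasurableSpace X] (μ : Measure X) [SigmaFinite μ]
    (hμ : μ univ = ∞) (T : X → X) (hT : InfiniteErgodic.IsCEMPT T μ)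
    (Y : Set X) (hY : MeasurableSet Y) (hY_pos : 0 < μ Y) (hY_fin : μ Y < ∞)
    (α : ℝ) (hα : α ∈ Ioo (0 : ℝ) 1)
    (l : ℝ → ℝ) (hl : InfiniteErgodic.IsSlowlyVarying l)
    (hw : (fun n : ℕ => InfiniteErgodic.wanderingRate T μ Y n) ~[atTop]
      fun n : ℕ => (n : ℝ) ^ (1 - α) * l n)
    (hB : ∃ C : ℝ≥0, ∀ n : ℕ, 1 ≤ n →
      eLpNorm (InfiniteErgodic.entranceMean T μ Y n) ∞ μ ≤ C) :
    (fun t : ℝ => InfiniteErgodic.normalizer T μ Y α t) ~[atTop]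
        (fun t : ℝ => t ^ α / (Real.Gamma (1 + α) * Real.Gamma (2 - α) * l t)) ∧
      ∀ c : ℕ → ℝ, (∀ n, 0 < c n) → Tendsto c atTop (𝓝 0) →
        Tendsto (fun n : ℕ => c n * InfiniteErgodic.normalizer T μ Y α n) atTop atTop →
        (fun n : ℕ => (μ.withDensity (Y.indicator 1)).real
            {x | InfiniteErgodic.occupationTime T Y n x /
              InfiniteErgodic.normalizer T μ Y α n ≤ c n}) ~[atTop]
          fun n : ℕ => Real.sin (Real.pi * α) / (Real.pi * α) * c n := by
  have hT := hT.ergodic.toMeasurePreserving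
  obtain ⟨C, hC⟩ := hB
  have hβ : 0 < 1 - α := by linarith [hα.2]
  have hQ := tendsto_wanderingLaplace_div hT hY hY_pos hY_fin hβ hl hw
  rw [show 1 + (1 - α) = 2 - α by ring] at hQ
  refine ⟨normalizer_isEquivalent hα hl hw hQ, fun c hc hc0 hca => ?_⟩
  set a : ℕ → ℝ := fun n => normalizer T μ Y α n with ha_def
  set w : ℕ → ℝ := wanderingRate T μ Y with hw_def
  set m : ℕ → ℕ := fun n => ⌊c n * a n⌋₊ + 1 with hm_def
  have hw0 : ∀ n, 1 ≤ n → 0 < w n := fun n hn => wanderingRate_pos hT hY hY_pos hY_fin hn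
  have hG1 : 0 < Real.Gamma (1 + α) := Real.Gamma_pos_of_pos (by linarith [hα.1])
  have hG2 : 0 < Real.Gamma (2 - α) := Real.Gamma_pos_of_pos (by linarith [hα.2])
  have hrv : ∀ x : ℝ, 0 < x →
      Tendsto (fun n : ℕ => w ⌊x * n⌋₊ / w n) atTop (𝓝 (x ^ (1 - α))) := by
    intro x hx
    have := (tendsto_regularlyVarying_div_floor hl hw hx
      (tendsto_nat_floor_mul_div_atTop hx.le)).comp tendsto_natCast_atTop_atTop
    simpa [Function.comp_def] using this
  -- `a n * w n / n` tends to `1 / (Γ(1+α) Γ(2-α))`.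
  have haw : Tendsto (fun n : ℕ => a n * w n / n) atTop
      (𝓝 (Real.Gamma (1 + α) * Real.Gamma (2 - α))⁻¹) := by
    have h1 := ((hQ.comp tendsto_natCast_atTop_atTop).const_mul (Real.Gamma (1 + α))).inv₀
      (mul_pos hG1 hG2).ne'
    refine h1.congr' ?_
    filter_upwards [eventually_ge_atTop 1] with n hn
    have hn0 : (0 : ℝ) < n := by exact_mod_cast hn
    have := hw0 n hn
    simp only [Function.comp, Nat.floor_natCast, ha_def, normalizer]
    by_cases hQ0 : wanderingLaplace T μ Y (n : ℝ)⁻¹ = 0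
    · simp [hQ0]
    field_simp
  have ha0 : ∀ᶠ n in atTop, 0 < a n := by
    filter_upwards [hca.eventually_gt_atTop 0] with n hn
    exact (mul_pos_iff_of_pos_left (hc n)).1 hn
  have hmc : Tendsto (fun n => (m n : ℝ) / (c n * a n)) atTop (𝓝 1) := by
    have h1 := (tendsto_nat_floor_div_atTop.comp hca).add (tendsto_inv_atTop_zero.comp hca)
    rw [add_zero] at h1
    refine h1.congr fun n => ?_
    simp only [Function.comp, hm_def]
    push_cast
    rw [add_div, one_div]
  have hmw : Tendsto (fun n : ℕ => (m n * w n / n) / c n) atTop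
      (𝓝 (Real.Gamma (1 + α) * Real.Gamma (2 - α))⁻¹) := by
    have h1 := hmc.mul haw
    rw [one_mul] at h1
    refine h1.congr' ?_
    filter_upwards [ha0] with n ha
    have := hc n
    field_simp
  have hm0 : Tendsto (fun n : ℕ => m n * w n / n) atTop (𝓝 0) := by
    have h1 := hmw.mul hc0
    rw [mul_zero] at h1
    exact h1.congr fun n => div_mul_cancel₀ _ (hc n).ne'
  have hdens := (sumBounds_fewReturns hT hY hY_pos hY_fin hC m).tendsto_density hw0
    (fun n => by positivity) hrv hm0
  -- With integer counts, `S_n ≤ c n * a n` means `S_n < m n`.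
  have hset : ∀ᶠ n in atTop, (μ.withDensity (Y.indicator 1)).real
      {x | occupationTime T Y n x / a n ≤ c n} = μ.real (fewReturns T Y (m n) n) := by
    filter_upwards [ha0] with n ha
    have hs : {x | occupationTime T Y n x / a n ≤ c n} = {x | visits T Y n (T x) < m n} := by
      ext x
      simp only [mem_ofPred_eq]
      rw [div_le_iff₀ ha, occupationTime_eq_visits, hm_def, Nat.lt_succ_iff,
        Nat.le_floor_iff (mul_pos (hc n) ha).le]
    rw [hs, withDensity_indicator_one hY, measureReal_restrict_apply
      (show MeasurableSet {x | visits T Y n (T x) < m n} from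
        measurableSet_lt ((measurable_visits hT.measurable hY n).comp hT.measurable)
          measurable_const), inter_comm]
    rfl
  -- Euler's reflection formula.
  have hsin : Real.sin (Real.pi * α) / (Real.pi * α) =
      (1 - α) * (Real.Gamma (1 + α) * Real.Gamma (2 - α))⁻¹ := by
    have e1 := Real.Gamma_mul_Gamma_one_sub α
    have e2 : Real.Gamma (1 + α) = α * Real.Gamma α := by
      rw [add_comm, Real.Gamma_add_one hα.1.ne']
    have e3 : Real.Gamma (2 - α) = (1 - α) * Real.Gamma (1 - α) := by
      rw [← Real.Gamma_add_one hβ.ne']; ring_nf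
    have hs : 0 < Real.sin (Real.pi * α) := Real.sin_pos_of_pos_of_lt_pi
      (mul_pos Real.pi_pos hα.1) (by nlinarith [Real.pi_pos, hα.2])
    have hα0 := hα.1
    rw [e2, e3, show α * Real.Gamma α * ((1 - α) * Real.Gamma (1 - α)) =
      α * (1 - α) * (Real.Gamma α * Real.Gamma (1 - α)) by ring, e1]
    field_simp
  rw [hsin]
  set K := (1 - α) * (Real.Gamma (1 + α) * Real.Gamma (2 - α))⁻¹ with hK_def
  have hK : 0 < K := by positivity
  refine (isEquivalent_iff_tendsto_one (Eventually.of_forall fun n =>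
    (mul_pos hK (hc n)).ne')).2 ?_
  have h1 := (hdens.mul hmw).div_const K
  rw [div_self hK.ne'] at h1
  refine h1.congr' ?_
  filter_upwards [hset, eventually_ge_atTop 1] with n hn hn1
  have hn0 : (0 : ℝ) < n := by exact_mod_cast hn1
  have e1 := hw0 n hn1
  have e2 := hc n
  have e3 : (0 : ℝ) < m n := by positivity
  simp only [Pi.div_apply]
  rw [hn, show wanderingRate T μ Y n = w n from rfl]
  field_simp
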